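/- Let $K$ be a field and let $X$ be a finite quandle with $\#X\ge 3$, i.e. a finite set with a binary operation $\triangleright$ such that each $g_t\colon s\mapsto t\triangleright s$ is bijective, $t\triangleright(s\triangleright r)=(t\triangleright s)\triangleright(t\triangleright r)$ and $t\triangleright t=t$. Assume that $X$ is indecomposable, i.e. the group $\mathrm{Inn}\,X$ of permutations of $X$ generated by all $g_t$ acts transitively on $X$. Let $\chi\colon X\times X\to K^\times$ be a 2-cocycle, i.e. $\chi(t,s\triangleright r)\,\chi(s,r)=\chi(t\triangleright s,t\triangleright r)\,\chi(t,r)$ for all $t,s,r\in X$, and let $m$ be its order, the least $m\ge 1$ with $\chi(t,t)^m=1$ for all $t\in X$ ($m=\infty$ if there is none). Let $V=KX$ be the vector space with basis $(e_t)_{t\in X}$ and braiding $c(e_t\otimes e_s)=\chi(t,s)\,e_{t\triangleright s}\otimes e_t$. Extend $c$ to the tensor algebra $TV$, and let $\Delta\colon TV\to TV\otimes TV$ be the coproduct that is multiplicative for the braided product $(\mu\otimes\mu)(\mathrm{id}\otimes c\otimes\mathrm{id})$ on $TV\otimes TV$ and satisfies $\Delta(v)=v\otimes 1+1\otimes v$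 for $v\in V$. Let $I$ be the largest homogeneous two-sided ideal of $TV$ with $\Delta(I)\subseteq I\otimes TV+TV\otimes I$ all of whose nonzero homogeneous elements have degree at least $2$, and let $\mathfrak B=TV/I$ be the Nichols algebra of $(X,\chi)$, with its induced grading $\mathfrak B=\bigoplus_{n\ge 0}\mathfrak B(n)$. If $\mathfrak B$ is finite-dimensional over $K$, then $m$ is finite, and the Hilbert series $\mathcal H_{\mathfrak B}(t)=\sum_{n\ge 0}\dim\mathfrak B(n)\,t^n$ is divisible by $(m)_t^2$ in $\mathbb Z[t]$, where $(m)_t=1+t+\cdots+t^{m-1}$. -/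

import Mathlib

open scoped TensorProduct Quandles

noncomputable section

namespace Nichols

/-- The inner group of a rack `X`: the permutation group generated by all
`g_t : s ↦ t ◃ s`, `t ∈ X`. -/
def Inn (X : Type*) [Rack X] : Subgroup (Equiv.Perm X) :=
  Subgroup.closure (Set.range (Rack.act' : X → Equiv.Perm X))

/-- A rack is indecomposable if its inner group acts transitively on it. -/
def IsIndecomposable (X : Type*) [Rack X] : Prop :=
  ∀ x y : X, ∃ g ∈ Inn X, g x = y

/-- A (rank one) 2-cocycle on the rack `X` with values in the nonzero elements of `K`. -/
structure TwoCocycle (X K : Type*) [Rack X] [Field K] where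
  /-- the values of the cocycle -/
  val : X → X → Kˣ
  cocycle : ∀ t s r : X, val t (s ◃ r) * val s r = val (t ◃ s) (t ◃ r) * val t r

/-- The order of a 2-cocycle: the least `m ≥ 1` with `χ(t,t)^m = 1` for all `t`. The value is `0`
if there is no such `m`. -/
def TwoCocycle.order {X K : Type*} [Rack X] [Field K] (χ : TwoCocycle X K) : ℕ :=
  sInf {m : ℕ | 0 < m ∧ ∀ t : X, χ.val t t ^ m = 1}

/-- The tensor algebra `TV` of `V = K X`, the vector space with basis `(e_t)`, `t ∈ X`. -/
abbrev TV (X K : Type*) [Field K] : Type _ := TensorAlgebra K (X →₀ K)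

/-- The generator `e_t` of `TV`. -/
def e (K : Type*) [Field K] {X : Type*} (t : X) : TV X K :=
  TensorAlgebra.ι K (Finsupp.single t 1)

/-- The degree `n` component `V^{⊗ n}` of `TV`. -/
abbrev grade (X K : Type*) [Field K] (n : ℕ) : Submodule K (TV X K) :=
  LinearMap.range (TensorAlgebra.ι K : (X →₀ K) →ₗ[K] TV X K) ^ n

/-- The algebra homomorphism out of `TV` with prescribed values on the generators `e_t`. -/
def liftGen {X K : Type*} [Field K] {A : Type*} [Ring A] [Algebra K A] (f : X → A) : TV X K →ₐ[K] A :=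
  TensorAlgebra.lift K (Finsupp.linearCombination K f)

@[simp]
theorem liftGen_e {X K : Type*} [Field K] {A : Type*} [Ring A] [Algebra K A] (f : X → A) (t : X) :
    liftGen f (e K t) = f t := by
  simp [liftGen, e]

/-- Induction on words in the generators, linearly extended. -/
theorem TV_induction {X K : Type*} [Field K] {p : TV X K → Prop} (one : p 1)
    (gen_mul : ∀ t v, p v → p (e K t * v)) (add : ∀ v w, p v → p w → p (v + w))
    (smul : ∀ (a : K) v, p v → p (a • v)) (v : TV X K) : p v := by
  have key : ∀ u : TV X K, ∀ v, p v → p (u * v) := by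
    intro u
    induction u using TensorAlgebra.induction with
    | algebraMap r => intro v hv; rw [← Algebra.smul_def]; exact smul r v hv
    | ι x =>
      intro v hv
      induction x using Finsupp.induction_linear with
      | zero => simpa using smul 0 v hv
      | add f g hf hg => rw [map_add, add_mul]; exact add _ _ hf hg
      | single t a =>
        have : Finsupp.single t a = a • Finsupp.single t (1 : K) := by simp
        rw [this, map_smul, smul_mul_assoc]
        exact smul _ _ (gen_mul t v hv)
    | mul a b ha hb => intro v hv; rw [mul_assoc]; exact ha _ (hb v hv)
    | add a b ha hb => intro v hv; rw [add_mul]; exact add _ _ (ha v hv) (hb v hv)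
  simpa using key v 1 one

section

variable {X K : Type*} [Rack X] [Field K] (χ : TwoCocycle X K)

/-- The action of `g_t` on `TV` by algebra endomorphisms, `g_t (e_s) = χ(t,s) e_{t ◃ s}`. -/
def gAct (t : X) : TV X K →ₐ[K] TV X K :=
  liftGen fun s => (χ.val t s : K) • e K (t ◃ s)

/-- The operators `w ⊗ v ↦ g_t(w) ⊗ e_t v` for the generators `e_t`, extended multiplicatively. -/
def braidOp : TV X K →ₐ[K] Module.End K (TV X K ⊗[K] TV X K) :=
  liftGen fun t =>
    TensorProduct.map (gAct χ t).toLinearMap (LinearMap.mulLeft K (e K t))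

/-- The braiding of `TV`, extending `c(e_t ⊗ w) = g_t(w) ⊗ e_t`:
`c(e_{t_1} ⋯ e_{t_k} ⊗ w) = g_{t_1} ⋯ g_{t_k}(w) ⊗ e_{t_1} ⋯ e_{t_k}`. -/
def braiding : TV X K ⊗[K] TV X K →ₗ[K] TV X K ⊗[K] TV X K :=
  TensorProduct.lift <| LinearMap.mk₂ K (fun v w => braidOp χ v (w ⊗ₜ 1))
    (fun _ _ _ => by simp) (fun _ _ _ => by simp)
    (fun _ _ _ => by rw [TensorProduct.add_tmul, map_add])
    (fun c _ _ => by rw [← TensorProduct.smul_tmul', map_smul])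

/-- The braided product `(μ ⊗ μ)(id ⊗ c ⊗ id)` on `TV ⊗ TV`. -/
def braidedMul :
    (TV X K ⊗[K] TV X K) ⊗[K] (TV X K ⊗[K] TV X K) →ₗ[K] TV X K ⊗[K] TV X K :=
  TensorProduct.map (LinearMap.mul' K (TV X K)) (LinearMap.mul' K (TV X K))
    ∘ₗ (TensorProduct.assoc K (TV X K) (TV X K) (TV X K ⊗[K] TV X K)).symm.toLinearMap
    ∘ₗ LinearMap.lTensor (TV X K)
      ((TensorProduct.assoc K (TV X K) (TV X K) (TV X K)).toLinearMap
        ∘ₗ LinearMap.rTensor (TV X K) (braiding χ)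
        ∘ₗ (TensorProduct.assoc K (TV X K) (TV X K) (TV X K)).symm.toLinearMap)
    ∘ₗ (TensorProduct.assoc K (TV X K) (TV X K) (TV X K ⊗[K] TV X K)).toLinearMap

/-- Left multiplication by `e_t ⊗ 1 + 1 ⊗ e_t` for the braided product of `TV ⊗ TV`. -/
def comulGen (t : X) : Module.End K (TV X K ⊗[K] TV X K) :=
  TensorProduct.map (LinearMap.mulLeft K (e K t)) LinearMap.id +
    TensorProduct.map (gAct χ t).toLinearMap (LinearMap.mulLeft K (e K t))

/-- The braided coproduct of `TV`, determined by `Δ(1) = 1 ⊗ 1` and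
`Δ(e_t v) = (e_t ⊗ 1 + 1 ⊗ e_t) Δ(v)`. -/
def comul : TV X K →ₗ[K] TV X K ⊗[K] TV X K :=
  LinearMap.applyₗ (1 ⊗ₜ[K] 1) ∘ₗ (liftGen (K := K) (comulGen χ)).toLinearMap

theorem comul_apply (v : TV X K) : comul χ v = liftGen (K := K) (comulGen χ) v (1 ⊗ₜ[K] 1) := rfl

/-- The generators are primitive. -/
theorem comul_e (t : X) : comul χ (e K t) = e K t ⊗ₜ 1 + 1 ⊗ₜ e K t := by
  simp [comul_apply, comulGen]

theorem comul_e_mul (t : X) (v : TV X K) : comul χ (e K t * v) = comulGen χ t (comul χ v) := by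
  simp [comul_apply]

theorem braidedMul_tmul (a b a' b' : TV X K) :
    braidedMul χ ((a ⊗ₜ b) ⊗ₜ (a' ⊗ₜ b')) =
      TensorProduct.map (LinearMap.mulLeft K a) (LinearMap.id) (braidOp χ b (a' ⊗ₜ b')) := by
  have h : braidOp χ b (a' ⊗ₜ b') =
      TensorProduct.map LinearMap.id (LinearMap.mulRight K b') (braidOp χ b (a' ⊗ₜ 1)) := by
    induction b using TV_induction with
    | one => simp
    | add v w hv hw => simp [hv, hw]
    | smul c v hv => simp [hv]
    | gen_mul t v hv =>
      simp only [map_mul, Module.End.mul_apply, hv]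
      simp only [braidOp, liftGen_e]
      generalize (liftGen _ v : Module.End K (TV X K ⊗[K] TV X K)) (a' ⊗ₜ[K] (1 : TV X K)) = y
      induction y using TensorProduct.induction_on with
      | zero => simp
      | add _ _ h1 h2 => simp only [map_add, h1, h2]
      | tmul p q => simp [mul_assoc]
  rw [h]
  simp only [braidedMul, LinearMap.comp_apply, LinearEquiv.coe_coe, TensorProduct.assoc_tmul,
    LinearMap.lTensor_tmul, TensorProduct.assoc_symm_tmul, LinearMap.rTensor_tmul, braiding,
    TensorProduct.lift.tmul, LinearMap.mk₂_apply]
  generalize braidOp χ b (a' ⊗ₜ[K] (1 : TV X K)) = y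
  induction y using TensorProduct.induction_on with
  | zero => simp
  | add _ _ h1 h2 => simp only [map_add, TensorProduct.add_tmul, TensorProduct.tmul_add, h1, h2]
  | tmul p q => simp

/-- The coproduct is multiplicative for the braided product: `Δ μ = (μ ⊗ μ)(id ⊗ c ⊗ id)(Δ ⊗ Δ)`. -/
theorem comul_mul (v w : TV X K) :
    comul χ (v * w) = braidedMul χ (comul χ v ⊗ₜ comul χ w) := by
  induction v using TV_induction with
  | one =>
    have h1 : comul χ (1 : TV X K) = 1 ⊗ₜ 1 := by simp [comul_apply]
    rw [h1, one_mul]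
    generalize comul χ w = y
    induction y using TensorProduct.induction_on with
    | zero => simp
    | add _ _ h1 h2 => rw [TensorProduct.tmul_add, map_add, ← h1, ← h2]
    | tmul p q => simp [braidedMul_tmul]
  | add v v' hv hv' => simp [add_mul, TensorProduct.add_tmul, hv, hv']
  | smul c v hv => rw [smul_mul_assoc, map_smul, map_smul, hv, ← TensorProduct.smul_tmul', map_smul]
  | gen_mul t v hv =>
    rw [mul_assoc, comul_e_mul, comul_e_mul, hv]
    generalize comul χ v = x
    generalize comul χ w = y
    induction x using TensorProduct.induction_on with
    | zero => simp
    | add _ _ h1 h2 => simp only [map_add, TensorProduct.add_tmul, h1, h2]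
    | tmul a b =>
      induction y using TensorProduct.induction_on with
      | zero => simp
      | add _ _ h1 h2 => simp only [map_add, TensorProduct.tmul_add, h1, h2]
      | tmul a' b' =>
        simp only [comulGen, LinearMap.add_apply, TensorProduct.map_tmul, TensorProduct.add_tmul,
          map_add, LinearMap.mulLeft_apply, LinearMap.id_apply, AlgHom.toLinearMap_apply,
          braidedMul_tmul, map_mul, Module.End.mul_apply]
        simp only [braidOp, liftGen_e]
        generalize (liftGen _ b : Module.End K (TV X K ⊗[K] TV X K)) (a' ⊗ₜ[K] b') = y
        congr 1
        all_goals
          induction y using TensorProduct.induction_on with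
          | zero => simp
          | add _ _ h1 h2 => simp only [map_add, h1, h2]
          | tmul p q => simp

/-- `J ⊗ TV + TV ⊗ J` as a subspace of `TV ⊗ TV`. -/
def coidealSubmodule {X K : Type*} [Field K] (J : Ideal (TV X K)) : Submodule K (TV X K ⊗[K] TV X K) :=
  LinearMap.range (TensorProduct.map (J.restrictScalars K).subtype LinearMap.id) ⊔
    LinearMap.range (TensorProduct.map LinearMap.id (J.restrictScalars K).subtype)

/-- The ideals entering the definition of the Nichols algebra: two-sided homogeneous ideals `J`
of `TV` with `Δ(J) ⊆ J ⊗ TV + TV ⊗ J` all of whose (nonzero) homogeneous elements have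
degree at least two. -/
structure IsAdmissible (J : Ideal (TV X K)) : Prop where
  isTwoSided : J.IsTwoSided
  isHomogeneous : J.IsHomogeneous (grade X K)
  coideal : ∀ x ∈ J, comul χ x ∈ coidealSubmodule J
  two_le : ∀ x ∈ J, ∀ n < 2, x ∈ grade X K n → x = 0

/-- The maximal admissible ideal of `TV`, as the sum of all of them. -/
def nicholsIdeal : Ideal (TV X K) := sSup {J | IsAdmissible χ J}

theorem nicholsIdeal_induction {p : TV X K → Prop}
    (mem : ∀ J, IsAdmissible χ J → ∀ x ∈ J, p x) (zero : p 0)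
    (add : ∀ x y, p x → p y → p (x + y)) {x : TV X K} (hx : x ∈ nicholsIdeal χ) : p x := by
  rw [nicholsIdeal, sSup_eq_iSup'] at hx
  exact Submodule.iSup_induction _ (motive := p) hx (fun J y hy => mem J J.2 y hy) zero add

instance : (nicholsIdeal χ).IsTwoSided where
  mul_mem_of_left b ha := by
    refine nicholsIdeal_induction χ (p := fun x => x * b ∈ nicholsIdeal χ) ?_ ?_ ?_ ha
    · intro J hJ x hx
      exact (le_sSup (show J ∈ {J | IsAdmissible χ J} from hJ) : J ≤ nicholsIdeal χ)
        (hJ.isTwoSided.mul_mem_of_left b hx)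
    · simp
    · intro x y hx hy
      rw [add_mul]
      exact add_mem hx hy

theorem coidealSubmodule_mono {X K : Type*} [Field K] {I J : Ideal (TV X K)} (h : I ≤ J) :
    coidealSubmodule I ≤ coidealSubmodule J := by
  refine sup_le_sup ?_ ?_
  · rintro _ ⟨y, rfl⟩
    refine ⟨TensorProduct.map (Submodule.inclusion
      (show I.restrictScalars K ≤ J.restrictScalars K from h)) LinearMap.id y, ?_⟩
    rw [← LinearMap.comp_apply, ← TensorProduct.map_comp]
    rfl
  · rintro _ ⟨y, rfl⟩
    refine ⟨TensorProduct.map LinearMap.id (Submodule.inclusion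
      (show I.restrictScalars K ≤ J.restrictScalars K from h)) y, ?_⟩
    rw [← LinearMap.comp_apply, ← TensorProduct.map_comp]
    rfl

/-- The sum of all admissible ideals is itself admissible, hence the unique maximal one. -/
theorem isGreatest_nicholsIdeal : IsGreatest {J | IsAdmissible χ J} (nicholsIdeal χ) := by
  refine ⟨⟨inferInstance, ?_, ?_, ?_⟩, fun J hJ => le_sSup hJ⟩
  · exact Ideal.IsHomogeneous.sSup fun J hJ => hJ.isHomogeneous
  · intro x hx
    refine nicholsIdeal_induction χ
      (p := fun x => comul χ x ∈ coidealSubmodule (nicholsIdeal χ)) ?_ ?_ ?_ hx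
    · intro J hJ y hy
      exact coidealSubmodule_mono (le_sSup (show J ∈ {J | IsAdmissible χ J} from hJ))
        (hJ.coideal y hy)
    · simp
    · intro y z hy hz
      rw [map_add]
      exact add_mem hy hz
  · intro x hx n hn hxn
    have key : GradedRing.proj (grade X K) n x = 0 := by
      refine nicholsIdeal_induction χ (p := fun x => GradedRing.proj (grade X K) n x = 0)
        ?_ ?_ ?_ hx
      · intro J hJ y hy
        exact hJ.two_le _ (hJ.isHomogeneous n hy) n hn (SetLike.coe_mem _)
      · simp
      · intro y z hy hz
        rw [map_add, hy, hz, add_zero]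
    rw [GradedRing.proj_apply, DirectSum.decompose_of_mem_same _ hxn] at key
    exact key

/-- The Nichols algebra `TV / I`. -/
abbrev NicholsAlgebra : Type _ := TV X K ⧸ nicholsIdeal χ

/-- The degree `n` component of the Nichols algebra. -/
def nicholsGrade (n : ℕ) : Submodule K (NicholsAlgebra χ) :=
  (grade X K n).map (Ideal.Quotient.mkₐ K (nicholsIdeal χ)).toLinearMap

/-- The Hilbert series `∑ dim 𝔅(n) tⁿ` of the Nichols algebra. -/
def hilbertSeries : PowerSeries ℤ :=
  PowerSeries.mk fun n => (Module.finrank K (nicholsGrade χ n) : ℤ)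

end

/-- The polynomial `(k)_t = 1 + t + ⋯ + t^{k-1}`. -/
def qNumber (k : ℕ) : Polynomial ℤ :=
  ∑ j ∈ Finset.range k, Polynomial.X ^ j

end Nichols

end

noncomputable section

namespace Nichols

/-! ### Graded spaces with a q-Weyl pair of operators -/

section QWeyl

variable {K M : Type*} [Field K] [AddCommGroup M] [Module K M]

/-! Indecomposability makes all `χ(t,t)` equal to one scalar `q`. For `x` in `X`, let `E` be the
right skew derivation at `x` and `R` right multiplication by `e_x`. Both descend to the Nichols
algebra and satisfy `E R = 1 + q R E`. Hence `E^j R^j` acts on `ker E` as the q-factorial of `j`. If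
`q` were not a root of unity, `R^N(1)` would be nonzero for every `N`, contradicting finite
dimension.

If `q ≠ 1` has order `m`, then `E^m = 0` while the q-factorials below `m` are invertible. The
filtration by `ker E^j` then shows that the Hilbert series is `(m)_t` times that of `ker E`
(`mk_finrank_eq_qNumber_mul`).

The second factor comes from the other side. Take `y ≠ x`, the left skew derivation `D` at `y` and
left multiplication `L` by `e_y`. Again `D L = 1 + q L D` and `D^m = 0`. As `D` commutes with `E`
(`leftDer_rightDer`), and so does `L` because `y ≠ x`, both preserve `ker E`, and the same splitting
applies there. If `q = 1`, then `m = 1` and the divisibility is trivial. -/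

theorem qWeyl_pow {E R : Module.End K M} {q : K} (h : ∀ v, E (R v) = v + q • R (E v))
    (j : ℕ) {v : M} (hv : E v = 0) :
    E ((R ^ (j + 1)) v) = (∑ i ∈ Finset.range (j + 1), q ^ i) • (R ^ j) v := by
  induction j with
  | zero => simp [h, hv]
  | succ j ih =>
    rw [pow_succ', Module.End.mul_apply, h, ih, map_smul, ← Module.End.mul_apply, ← pow_succ',
      Finset.sum_range_succ' _ (j + 1), add_smul, pow_zero, one_smul, smul_smul, Finset.mul_sum,
      add_comm]
    simp only [pow_succ']

theorem qWeyl_pow_pow {E R : Module.End K M} {q : K} (h : ∀ v, E (R v) = v + q • R (E v))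
    (j : ℕ) {v : M} (hv : E v = 0) :
    (E ^ j) ((R ^ j) v) =
      (∏ k ∈ Finset.range j, ∑ i ∈ Finset.range (k + 1), q ^ i) • v := by
  induction j with
  | zero => simp
  | succ j ih =>
    rw [pow_succ E, Module.End.mul_apply, qWeyl_pow h j hv, map_smul, ih, smul_smul,
      Finset.prod_range_succ, mul_comm]

theorem map_pow_mem {A : ℕ → Submodule K M} {E : Module.End K M}
    (hE : ∀ n, ∀ v ∈ A (n + 1), E v ∈ A n) (j n : ℕ) {v : M} (hv : v ∈ A (n + j)) :
    (E ^ j) v ∈ A n := by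
  induction j generalizing v with
  | zero => simpa using hv
  | succ j ih =>
    rw [pow_succ, Module.End.mul_apply]
    exact ih (hE _ _ hv)

theorem map_pow_eq_zero {A : ℕ → Submodule K M} {E : Module.End K M}
    (hE : ∀ n, ∀ v ∈ A (n + 1), E v ∈ A n) (hE0 : ∀ v ∈ A 0, E v = 0) {j n : ℕ} (hn : n < j)
    {v : M} (hv : v ∈ A n) : (E ^ j) v = 0 := by
  obtain ⟨k, rfl⟩ : ∃ k, j = (k + 1) + n := ⟨j - n - 1, by omega⟩
  rw [pow_add, Module.End.mul_apply, pow_succ, Module.End.mul_apply,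
    hE0 _ (map_pow_mem hE n 0 (by simpa using hv)), map_zero]

theorem raise_pow_mem {A : ℕ → Submodule K M} {R : Module.End K M}
    (hR : ∀ n, ∀ v ∈ A n, R v ∈ A (n + 1)) (j n : ℕ) {v : M} (hv : v ∈ A n) :
    (R ^ j) v ∈ A (n + j) := by
  induction j with
  | zero => simpa using hv
  | succ j ih =>
    rw [pow_succ', Module.End.mul_apply]
    exact hR _ _ ih

/-- Rank-nullity for `E^j` restricted to `A n ⊓ ker E^(j+1)`: its kernel is `A n ⊓ ker E^j`, and it
maps onto `A (n-j) ⊓ ker E` since `R^j` is a section up to the q-factorial. For `n < j` the operator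
`E^j` already kills `A n`. -/
theorem finrank_inf_ker_pow_succ [FiniteDimensional K M] {A : ℕ → Submodule K M}
    {E R : Module.End K M} {q : K} (h : ∀ v, E (R v) = v + q • R (E v))
    (hE : ∀ n, ∀ v ∈ A (n + 1), E v ∈ A n) (hE0 : ∀ v ∈ A 0, E v = 0)
    (hR : ∀ n, ∀ v ∈ A n, R v ∈ A (n + 1)) {j : ℕ}
    (hq : ∀ k < j, ∑ i ∈ Finset.range (k + 1), q ^ i ≠ 0) (n : ℕ) :
    Module.finrank K (A n ⊓ LinearMap.ker (E ^ (j + 1)) : Submodule K M) =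
      Module.finrank K (A n ⊓ LinearMap.ker (E ^ j) : Submodule K M) +
        if j ≤ n then Module.finrank K (A (n - j) ⊓ LinearMap.ker E : Submodule K M) else 0 := by
  split_ifs with hjn
  · obtain ⟨k, rfl⟩ := Nat.exists_eq_add_of_le' hjn
    rw [Nat.add_sub_cancel]
    set p := A (k + j) ⊓ LinearMap.ker (E ^ (j + 1))
    have hrange : LinearMap.range ((E ^ j).domRestrict p) = A k ⊓ LinearMap.ker E := by
      apply le_antisymm
      · rintro _ ⟨⟨v, hv⟩, rfl⟩
        refine ⟨map_pow_mem hE j k hv.1, ?_⟩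
        have hv' := LinearMap.mem_ker.1 hv.2
        rwa [pow_succ'] at hv'
      · rintro v ⟨hv, hv'⟩
        replace hv' := LinearMap.mem_ker.1 hv'
        set c := ∏ k ∈ Finset.range j, ∑ i ∈ Finset.range (k + 1), q ^ i
        have hc0 : c ≠ 0 := Finset.prod_ne_zero_iff.2 fun k hk => hq k (Finset.mem_range.1 hk)
        have key := qWeyl_pow_pow h j hv'
        -- The preimage is `R^j v` divided by the q-factorial `c`.
        refine ⟨⟨c⁻¹ • (R ^ j) v, Submodule.smul_mem _ _ ⟨raise_pow_mem hR j k hv, ?_⟩⟩, ?_⟩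
        · refine LinearMap.mem_ker.2 ?_
          rw [pow_succ', Module.End.mul_apply, key, map_smul, hv', smul_zero]
        · rw [LinearMap.domRestrict_apply, map_smul, key, smul_smul, inv_mul_cancel₀ hc0, one_smul]
    have hker : Module.finrank K (LinearMap.ker ((E ^ j).domRestrict p)) =
        Module.finrank K (A (k + j) ⊓ LinearMap.ker (E ^ j) : Submodule K M) := by
      have hle : A (k + j) ⊓ LinearMap.ker (E ^ j) ≤ p := by
        refine inf_le_inf_left _ fun v hv => ?_
        rw [LinearMap.mem_ker] at hv ⊢
        rw [pow_succ', Module.End.mul_apply, hv, map_zero]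
      rw [← (Submodule.comapSubtypeEquivOfLe hle).finrank_eq]
      have : LinearMap.ker ((E ^ j).domRestrict p) =
          Submodule.comap p.subtype (A (k + j) ⊓ LinearMap.ker (E ^ j)) := by
        ext ⟨v, hv⟩
        simpa using fun _ => hv.1
      rw [this]
    have := LinearMap.finrank_range_add_finrank_ker ((E ^ j).domRestrict p)
    rw [hrange, hker] at this
    omega
  · rw [not_le] at hjn
    have h1 : A n ⊓ LinearMap.ker (E ^ (j + 1)) = A n :=
      inf_eq_left.2 fun v hv => map_pow_eq_zero hE hE0 (by omega) hv
    have h2 : A n ⊓ LinearMap.ker (E ^ j) = A n :=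
      inf_eq_left.2 fun v hv => map_pow_eq_zero hE hE0 hjn hv
    rw [h1, h2, add_zero]

/-- A graded space with operators `E`, `R` of degrees `-1`, `1` such that `E R = 1 + q R E` and
`E ^ m = 0` is the tensor product of `ker E` with a string of length `m`. -/
theorem mk_finrank_eq_qNumber_mul [FiniteDimensional K M] {A : ℕ → Submodule K M}
    {E R : Module.End K M} {q : K} (h : ∀ v, E (R v) = v + q • R (E v))
    (hE : ∀ n, ∀ v ∈ A (n + 1), E v ∈ A n) (hE0 : ∀ v ∈ A 0, E v = 0)
    (hR : ∀ n, ∀ v ∈ A n, R v ∈ A (n + 1)) {m : ℕ} (hm : E ^ m = 0)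
    (hq : ∀ k, k + 1 < m → ∑ i ∈ Finset.range (k + 1), q ^ i ≠ 0) :
    PowerSeries.mk (fun n => (Module.finrank K (A n) : ℤ)) =
      ((qNumber m : Polynomial ℤ) : PowerSeries ℤ) *
        PowerSeries.mk fun n =>
          (Module.finrank K (A n ⊓ LinearMap.ker E : Submodule K M) : ℤ) := by
  ext n
  -- Summing over the layers of the filtration; at `j = m` this is the convolution with `1 + t + ⋯ +
  -- t^(m-1)`.
  have key : ∀ j ≤ m, Module.finrank K (A n ⊓ LinearMap.ker (E ^ j) : Submodule K M) =
      ∑ i ∈ Finset.range j,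
        if i ≤ n then Module.finrank K (A (n - i) ⊓ LinearMap.ker E : Submodule K M) else 0 := by
    intro j hj
    induction j with
    | zero =>
      have : LinearMap.ker (1 : Module.End K M) = ⊥ := LinearMap.ker_id
      simp [this]
    | succ j ih =>
      rw [finrank_inf_ker_pow_succ h hE hE0 hR (fun k hk => hq k (by omega)),
        ih (by omega), Finset.sum_range_succ]
  have hm' := key m le_rfl
  rw [hm, LinearMap.ker_zero, inf_top_eq] at hm'
  simp only [qNumber, PowerSeries.coeff_mk, hm',
    ← Polynomial.coeToPowerSeries.ringHom_apply, map_sum, map_pow, Finset.sum_mul]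
  simp [PowerSeries.coeff_X_pow_mul']

end QWeyl

/-! ### Counit, degree-one coefficients and induction on the grading of `TV` -/

section Functionals

variable {X K : Type*} [Field K]

/-- The counit of `TV`. -/
def counit : TV X K →ₐ[K] K := liftGen fun _ => 0

open scoped Classical in
/-- The coefficient of `e_x` as a linear form on `TV`. -/
def coeffGen (x : X) : TV X K →ₗ[K] K :=
  TrivSqZeroExt.sndHom K K ∘ₗ
    (liftGen fun s => if s = x then TrivSqZeroExt.inr 1 else 0 :
      TV X K →ₐ[K] TrivSqZeroExt K K).toLinearMap

theorem counit_e_mul (s : X) (v : TV X K) : counit (e K s * v) = 0 := by simp [counit]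

theorem coeffGen_one (x : X) : coeffGen x (1 : TV X K) = 0 := by simp [coeffGen]

open scoped Classical in
theorem coeffGen_e_mul (x s : X) (v : TV X K) :
    coeffGen x (e K s * v) = if s = x then counit v else 0 := by
  -- The scalar part of the map to the dual numbers is the counit, and multiplying by `ε` moves it
  -- into the `ε`-part.
  have h : ∀ v : TV X K, (liftGen (fun s => if s = x then TrivSqZeroExt.inr 1 else 0) v :
      TrivSqZeroExt K K).fst = counit v := by
    intro v
    induction v using TV_induction with
    | one => simp
    | add v w hv hw => rw [map_add, map_add, TrivSqZeroExt.fst_add, hv, hw]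
    | smul a v hv => rw [map_smul, map_smul, TrivSqZeroExt.fst_smul, hv]
    | gen_mul s v hv => rw [counit_e_mul, map_mul, liftGen_e]; split_ifs <;> simp
  simp only [coeffGen, LinearMap.comp_apply, AlgHom.toLinearMap_apply, map_mul, liftGen_e,
    TrivSqZeroExt.sndHom_apply]
  rw [← h v]
  split_ifs <;> simp

theorem e_mul_mem_grade (t : X) {n : ℕ} {v : TV X K} (hv : v ∈ grade X K n) :
    e K t * v ∈ grade X K (n + 1) := by
  rw [grade, pow_succ']
  exact Submodule.mul_mem_mul ⟨_, rfl⟩ hv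

theorem mul_e_mem_grade (t : X) {n : ℕ} {v : TV X K} (hv : v ∈ grade X K n) :
    v * e K t ∈ grade X K (n + 1) := by
  rw [grade, pow_succ]
  exact Submodule.mul_mem_mul hv ⟨_, rfl⟩

theorem grade_succ_induction {n : ℕ} {p : (v : TV X K) → v ∈ grade X K (n + 1) → Prop}
    (zero : p 0 (zero_mem _))
    (gen_mul : ∀ t v (hv : v ∈ grade X K n), p (e K t * v) (e_mul_mem_grade t hv))
    (add : ∀ v w hv hw, p v hv → p w hw → p (v + w) (add_mem hv hw))
    (smul : ∀ (a : K) v hv, p v hv → p (a • v) (Submodule.smul_mem _ a hv))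
    {v : TV X K} (hv : v ∈ grade X K (n + 1)) : p v hv := by
  suffices ∃ h, p v h from this.2
  have hv' := hv
  rw [grade, pow_succ'] at hv'
  refine Submodule.mul_induction_on hv' ?_ fun v w ⟨_, hv⟩ ⟨_, hw⟩ => ⟨_, add _ _ _ _ hv hw⟩
  rintro _ ⟨x, rfl⟩ w hw
  induction x using Finsupp.induction_linear with
  | zero => rw [map_zero, zero_mul]; exact ⟨_, zero⟩
  | add f g hf hg =>
    rw [map_add, add_mul]
    exact ⟨_, add _ _ _ _ hf.2 hg.2⟩
  | single t a =>
    have : Finsupp.single t a = a • Finsupp.single t (1 : K) := by simp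
    rw [this, map_smul, smul_mul_assoc]
    exact ⟨_, smul a _ _ (gen_mul t w hw)⟩

theorem exists_of_mem_grade_zero {v : TV X K} (hv : v ∈ grade X K 0) :
    ∃ a : K, v = a • 1 := by
  rw [grade, pow_zero, Submodule.mem_one] at hv
  obtain ⟨a, rfl⟩ := hv
  exact ⟨a, Algebra.algebraMap_eq_smul_one a⟩

theorem coeffGen_eq_zero_of_mem_grade (x : X) {n : ℕ} (hn : n ≠ 1) {v : TV X K}
    (hv : v ∈ grade X K n) : coeffGen x v = 0 := by
  classical
  obtain _ | _ | n := n
  · obtain ⟨a, rfl⟩ := exists_of_mem_grade_zero hv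
    simp [coeffGen_one]
  · simp at hn
  · induction hv using grade_succ_induction with
    | zero => simp
    | gen_mul t v hv =>
      have : counit v = 0 := by
        induction hv using grade_succ_induction with
        | zero => simp
        | gen_mul t v hv => exact counit_e_mul t v
        | add v w _ _ hv hw => rw [map_add, hv, hw, add_zero]
        | smul a v _ hv => rw [map_smul, hv, smul_zero]
      simp [coeffGen_e_mul, this]
    | add v w _ _ hv hw => rw [map_add, hv, hw, add_zero]
    | smul a v _ hv => rw [map_smul, hv, smul_zero]

end Functionals

/-! ### Skew derivations of the tensor algebra -/

section Derivations

variable {X K : Type*} [Rack X] [Field K] (χ : TwoCocycle X K)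

/-- The right skew derivation `(id ⊗ e_x^*) Δ` of `TV`. -/
def rightDer (x : X) : Module.End K (TV X K) :=
  (TensorProduct.rid K (TV X K)).toLinearMap ∘ₗ LinearMap.lTensor _ (coeffGen x) ∘ₗ comul χ

/-- The left skew derivation `(e_y^* ⊗ id) Δ` of `TV`. -/
def leftDer (y : X) : Module.End K (TV X K) :=
  (TensorProduct.lid K (TV X K)).toLinearMap ∘ₗ LinearMap.rTensor _ (coeffGen y) ∘ₗ comul χ

theorem comul_one : comul χ 1 = 1 ⊗ₜ 1 := by simp [comul_apply]

theorem gAct_e (t s : X) : gAct χ t (e K s) = (χ.val t s : K) • e K (t ◃ s) := by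
  simp [gAct]

theorem gAct_e_mul (t s : X) (v : TV X K) :
    gAct χ t (e K s * v) = (χ.val t s : K) • (e K (t ◃ s) * gAct χ t v) := by
  rw [map_mul, gAct_e, smul_mul_assoc]

theorem counit_gAct (t : X) (v : TV X K) : counit (gAct χ t v) = counit v := by
  induction v using TV_induction with
  | one => simp
  | add v w hv hw => simp [hv, hw]
  | smul a v hv => simp [hv]
  | gen_mul s v hv => rw [gAct_e_mul, map_smul, counit_e_mul, counit_e_mul, smul_zero]

theorem coeffGen_gAct (t r : X) (v : TV X K) :
    coeffGen (t ◃ r) (gAct χ t v) = χ.val t r * coeffGen r v := by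
  classical
  induction v using TV_induction with
  | one => simp [coeffGen_one]
  | add v w hv hw => simp [hv, hw, mul_add]
  | smul a v hv => simp only [map_smul, hv, smul_eq_mul]; ring
  | gen_mul s v hv =>
    rw [gAct_e_mul, map_smul, coeffGen_e_mul, coeffGen_e_mul, counit_gAct]
    by_cases h : s = r
    · simp [h]
    · rw [if_neg h, if_neg (fun h' => h ((Rack.left_cancel t).1 h'))]
      simp

theorem lTensor_counit_comul (v : TV X K) :
    TensorProduct.rid K (TV X K) (LinearMap.lTensor _ counit.toLinearMap (comul χ v)) = v := by
  induction v using TV_induction with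
  | one => simp [comul_one]
  | add v w hv hw => simp [hv, hw]
  | smul a v hv => simp [hv]
  | gen_mul s v hv =>
    rw [comul_e_mul]
    nth_rewrite 2 [← hv]
    generalize comul χ v = z
    induction z using TensorProduct.induction_on with
    | zero => simp
    | add _ _ h1 h2 => simp only [map_add, h1, h2, mul_add]
    | tmul a b => simp [comulGen, counit_e_mul]

theorem rTensor_counit_comul (v : TV X K) :
    TensorProduct.lid K (TV X K) (LinearMap.rTensor _ counit.toLinearMap (comul χ v)) = v := by
  induction v using TV_induction with
  | one => simp [comul_one]
  | add v w hv hw => simp [hv, hw]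
  | smul a v hv => simp [hv]
  | gen_mul s v hv =>
    rw [comul_e_mul]
    nth_rewrite 2 [← hv]
    generalize comul χ v = z
    induction z using TensorProduct.induction_on with
    | zero => simp
    | add _ _ h1 h2 => simp only [map_add, h1, h2, mul_add]
    | tmul a b =>
      simp only [comulGen, LinearMap.add_apply, TensorProduct.map_tmul, LinearMap.mulLeft_apply,
        LinearMap.id_apply, AlgHom.toLinearMap_apply, map_add, LinearMap.rTensor_tmul,
        counit_e_mul, counit_gAct, TensorProduct.lid_tmul, zero_smul, zero_add, mul_smul_comm]

theorem rightDer_one (x : X) : rightDer χ x 1 = 0 := by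
  simp [rightDer, comul_one, coeffGen_one]

theorem leftDer_one (x : X) : leftDer χ x 1 = 0 := by
  simp [leftDer, comul_one, coeffGen_one]

-- In `(e_s ⊗ 1 + 1 ⊗ e_s) Δ(v)` the second summand survives `id ⊗ e_x^*` only for `s = x`; it then
-- leaves the counit on the right factor, hence `g_s(v)`.
open scoped Classical in
theorem rightDer_e_mul (x s : X) (v : TV X K) :
    rightDer χ x (e K s * v) =
      e K s * rightDer χ x v + if s = x then gAct χ s v else 0 := by
  nth_rewrite 3 [← lTensor_counit_comul χ v]
  simp only [rightDer, LinearMap.comp_apply, LinearEquiv.coe_coe, comul_e_mul]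
  generalize comul χ v = z
  induction z using TensorProduct.induction_on with
  | zero => simp
  | add _ _ h1 h2 =>
    simp only [map_add, h1, h2, mul_add]
    split_ifs
    · abel
    · simp
  | tmul a b =>
    simp only [comulGen, LinearMap.add_apply, TensorProduct.map_tmul, LinearMap.mulLeft_apply,
        LinearMap.id_apply, AlgHom.toLinearMap_apply, map_add, LinearMap.lTensor_tmul,
        coeffGen_e_mul, TensorProduct.rid_tmul, mul_smul_comm, map_smul]
    split_ifs <;> simp

-- The index is written `s ◃ r` because `e_{s ◃ r}^* ∘ g_s = χ(s,r) e_r^*`. Every index has this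
-- form, as `s ◃ ·` is bijective.
open scoped Classical in
theorem leftDer_e_mul (s r : X) (v : TV X K) :
    leftDer χ (s ◃ r) (e K s * v) =
      (if s = s ◃ r then v else 0) + (χ.val s r : K) • (e K s * leftDer χ r v) := by
  nth_rewrite 2 [← rTensor_counit_comul χ v]
  simp only [leftDer, LinearMap.comp_apply, LinearEquiv.coe_coe, comul_e_mul]
  generalize comul χ v = z
  induction z using TensorProduct.induction_on with
  | zero => simp
  | add _ _ h1 h2 =>
    simp only [map_add, h1, h2, mul_add, smul_add]
    split_ifs
    · abel
    · simp
  | tmul a b =>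
    simp only [comulGen, LinearMap.add_apply, TensorProduct.map_tmul, LinearMap.mulLeft_apply,
        LinearMap.id_apply, AlgHom.toLinearMap_apply, map_add, LinearMap.rTensor_tmul,
        coeffGen_e_mul, coeffGen_gAct, TensorProduct.lid_tmul, mul_smul_comm]
    split_ifs <;> simp [mul_smul]

theorem gAct_mem_grade (t : X) {n : ℕ} {v : TV X K} (hv : v ∈ grade X K n) :
    gAct χ t v ∈ grade X K n := by
  induction n generalizing v with
  | zero =>
    obtain ⟨a, rfl⟩ := exists_of_mem_grade_zero hv
    simpa using hv
  | succ n ih =>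
    induction hv using grade_succ_induction with
    | zero => simp
    | gen_mul s v hv =>
      rw [gAct_e_mul]; exact Submodule.smul_mem _ _ (e_mul_mem_grade _ (ih hv))
    | add v w _ _ hv hw => rw [map_add]; exact add_mem hv hw
    | smul a v _ hv => rw [map_smul]; exact Submodule.smul_mem _ _ hv

theorem rightDer_mem_grade (x : X) {n : ℕ} {v : TV X K} (hv : v ∈ grade X K (n + 1)) :
    rightDer χ x v ∈ grade X K n := by
  classical
  induction n generalizing v with
  | zero =>
    induction hv using grade_succ_induction with
    | zero => simp
    | gen_mul s v hv =>
      have h := gAct_mem_grade χ s hv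
      obtain ⟨a, rfl⟩ := exists_of_mem_grade_zero hv
      rw [rightDer_e_mul, map_smul, rightDer_one, smul_zero, mul_zero, zero_add]
      split_ifs
      exacts [h, zero_mem _]
    | add v w _ _ hv hw => rw [map_add]; exact add_mem hv hw
    | smul a v _ hv => rw [map_smul]; exact Submodule.smul_mem _ _ hv
  | succ n ih =>
    induction hv using grade_succ_induction with
    | zero => simp
    | gen_mul s v hv =>
      rw [rightDer_e_mul]
      refine add_mem (e_mul_mem_grade s (ih hv)) ?_
      split_ifs
      exacts [gAct_mem_grade χ s hv, zero_mem _]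
    | add v w _ _ hv hw => rw [map_add]; exact add_mem hv hw
    | smul a v _ hv => rw [map_smul]; exact Submodule.smul_mem _ _ hv

theorem leftDer_mem_grade (y : X) {n : ℕ} {v : TV X K} (hv : v ∈ grade X K (n + 1)) :
    leftDer χ y v ∈ grade X K n := by
  classical
  induction n generalizing v y with
  | zero =>
    induction hv using grade_succ_induction with
    | zero => simp
    | gen_mul s v hv =>
      obtain ⟨r, rfl⟩ : ∃ r, s ◃ r = y := ⟨s ◃⁻¹ y, Rack.right_inv s y⟩
      rw [leftDer_e_mul]
      have h : leftDer χ r v = 0 := by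
        obtain ⟨a, rfl⟩ := exists_of_mem_grade_zero hv
        rw [map_smul, leftDer_one, smul_zero]
      rw [h, mul_zero, smul_zero, add_zero]
      split_ifs
      exacts [hv, zero_mem _]
    | add v w _ _ hv hw => rw [map_add]; exact add_mem hv hw
    | smul a v _ hv => rw [map_smul]; exact Submodule.smul_mem _ _ hv
  | succ n ih =>
    induction hv using grade_succ_induction with
    | zero => simp
    | gen_mul s v hv =>
      obtain ⟨r, rfl⟩ : ∃ r, s ◃ r = y := ⟨s ◃⁻¹ y, Rack.right_inv s y⟩
      rw [leftDer_e_mul]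
      refine add_mem ?_ (Submodule.smul_mem _ _ (e_mul_mem_grade s (ih r hv)))
      split_ifs
      exacts [hv, zero_mem _]
    | add v w _ _ hv hw => rw [map_add]; exact add_mem hv hw
    | smul a v _ hv => rw [map_smul]; exact Submodule.smul_mem _ _ hv

/-- Equivariance of the left derivations under `g_t`; this is where the cocycle condition and
self-distributivity enter. -/
theorem leftDer_gAct (t r : X) (v : TV X K) :
    leftDer χ (t ◃ r) (gAct χ t v) = (χ.val t r : K) • gAct χ t (leftDer χ r v) := by
  classical
  induction v using TV_induction generalizing r with
  | one => simp [leftDer_one]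
  | add v w hv hw => simp [hv, hw]
  | smul a v hv => simp only [map_smul, hv, smul_comm a]
  | gen_mul s v hv =>
    obtain ⟨u, rfl⟩ : ∃ u, s ◃ u = r := ⟨s ◃⁻¹ r, Rack.right_inv s r⟩
    have hc : (χ.val (t ◃ s) (t ◃ u) : K) * χ.val t u = χ.val t (s ◃ u) * χ.val s u := by
      exact_mod_cast (χ.cocycle t s u).symm
    rw [gAct_e_mul, map_smul, Rack.self_distrib, leftDer_e_mul, leftDer_e_mul, hv, map_add,
      map_smul, gAct_e_mul, ← Rack.self_distrib]
    simp only [Rack.left_cancel, smul_add, mul_smul_comm, smul_smul]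
    congr 1
    · by_cases h : s = s ◃ u
      · simp [← h]
      · simp [h]
    · congr 1
      linear_combination (χ.val t s : K) * hc

/-- The two derivations strip letters from opposite ends. In the induction, the only term not
handled by the hypothesis is `g_s(v)`, which `leftDer_gAct` settles. -/
theorem leftDer_rightDer (x y : X) (v : TV X K) :
    leftDer χ y (rightDer χ x v) = rightDer χ x (leftDer χ y v) := by
  classical
  induction v using TV_induction generalizing y with
  | one => simp [leftDer_one, rightDer_one]
  | add v w hv hw => simp [hv, hw]
  | smul a v hv => simp [hv]
  | gen_mul s v hv =>
    obtain ⟨r, rfl⟩ : ∃ r, s ◃ r = y := ⟨s ◃⁻¹ y, Rack.right_inv s y⟩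
    rw [leftDer_e_mul, rightDer_e_mul, map_add, map_add, leftDer_e_mul, map_smul, rightDer_e_mul,
      hv]
    split_ifs <;> simp [leftDer_gAct, add_assoc]

end Derivations

/-! ### The q-Weyl relations and nilpotency, using `t ◃ t = t` -/

section Quandle

variable {X K : Type*} [Quandle X] [Field K] (χ : TwoCocycle X K)

theorem rightDer_gAct (x : X) (v : TV X K) :
    rightDer χ x (gAct χ x v) = (χ.val x x : K) • gAct χ x (rightDer χ x v) := by
  classical
  induction v using TV_induction with
  | one => simp [rightDer_one]
  | add v w hv hw => simp [hv, hw]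
  | smul a v hv => simp only [map_smul, hv, smul_comm a]
  | gen_mul s v hv =>
    rw [gAct_e_mul, map_smul, rightDer_e_mul, rightDer_e_mul, hv, map_add, gAct_e_mul]
    by_cases h : s = x
    · subst h
      simp [Quandle.fix, smul_smul]
    · have : x ◃ s ≠ x := fun h' => h ((Rack.left_cancel x).1 (h'.trans Quandle.fix.symm))
      simp [h, this, smul_smul, mul_comm]

/-- The factor `χ(x,x)` arises when `g_x` passes the last letter: `g_x(v e_x) = χ(x,x) g_x(v) e_x`.
-/
theorem rightDer_mul_e (x : X) (v : TV X K) :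
    rightDer χ x (v * e K x) = v + (χ.val x x : K) • (rightDer χ x v * e K x) := by
  classical
  induction v using TV_induction with
  | one =>
    have := rightDer_e_mul χ x x 1
    rw [mul_one] at this
    simp [rightDer_one, this]
  | add v w hv hw => simp only [add_mul, map_add, hv, hw, smul_add]; abel
  | smul a v hv => simp only [smul_mul_assoc, map_smul, hv, smul_comm a, smul_add]
  | gen_mul s v hv =>
    rw [mul_assoc, rightDer_e_mul, rightDer_e_mul, hv, mul_add, add_mul, smul_add, mul_assoc,
      mul_smul_comm, add_assoc]
    congr 2
    by_cases h : s = x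
    · subst h
      simp [gAct_e, Quandle.fix]
    · simp [h]

theorem leftDer_self_e_mul (y : X) (v : TV X K) :
    leftDer χ y (e K y * v) = v + (χ.val y y : K) • (e K y * leftDer χ y v) := by
  have := leftDer_e_mul χ y y v
  simpa [Quandle.fix] using this

theorem rightDer_pow_e_mul (x : X) (k : ℕ) (v : TV X K) :
    (rightDer χ x ^ (k + 1)) (e K x * v) = e K x * (rightDer χ x ^ (k + 1)) v +
      (∑ i ∈ Finset.range (k + 1), (χ.val x x : K) ^ i) •
        gAct χ x ((rightDer χ x ^ k) v) := by
  induction k with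
  | zero => simp [rightDer_e_mul]
  | succ k ih =>
    rw [pow_succ' _ (k + 1), Module.End.mul_apply, ih, map_add, map_smul, rightDer_gAct,
      rightDer_e_mul, if_pos rfl, Module.End.mul_apply,
      ← Module.End.mul_apply (rightDer χ x) (rightDer χ x ^ k), ← pow_succ',
      Finset.sum_range_succ' _ (k + 1), add_smul, smul_smul, Finset.sum_mul, add_assoc]
    simp [pow_succ, add_comm]

/-- The power kills `1` and commutes with left multiplication by every `e_s`: for `s ≠ x` the
derivation itself does, and for `s = x` the correction term carries the vanishing q-number of `m`.
-/
theorem rightDer_pow_eq_zero (x : X) {m : ℕ} (hm : 0 < m)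
    (hq : ∑ i ∈ Finset.range m, (χ.val x x : K) ^ i = 0) : rightDer χ x ^ m = 0 := by
  classical
  obtain ⟨k, rfl⟩ := Nat.exists_eq_succ_of_ne_zero hm.ne'
  ext1 v
  induction v using TV_induction with
  | one => simp [pow_succ, rightDer_one]
  | add v w hv hw => rw [map_add, hv, hw]; simp
  | smul a v hv => rw [map_smul, hv]; simp
  | gen_mul s v hv =>
    by_cases h : s = x
    · subst h
      rw [Nat.succ_eq_add_one, rightDer_pow_e_mul, hq, zero_smul, add_zero]
      rw [hv]; simp
    · have : ∀ j, (rightDer χ x ^ j) (e K s * v) = e K s * (rightDer χ x ^ j) v := by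
        intro j
        induction j with
        | zero => simp
        | succ j ih => simp [pow_succ', ih, rightDer_e_mul, h]
      rw [this, hv]; simp

theorem leftDer_pow_self_e_mul (y : X) (k : ℕ) (v : TV X K) :
    (leftDer χ y ^ (k + 1)) (e K y * v) =
      (χ.val y y : K) ^ (k + 1) • (e K y * (leftDer χ y ^ (k + 1)) v) +
      (∑ i ∈ Finset.range (k + 1), (χ.val y y : K) ^ i) • (leftDer χ y ^ k) v := by
  induction k with
  | zero => simp [leftDer_self_e_mul, add_comm]
  | succ k ih =>
    rw [pow_succ' _ (k + 1), Module.End.mul_apply, ih, map_add, map_smul, map_smul,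
      leftDer_self_e_mul, Module.End.mul_apply,
      ← Module.End.mul_apply (leftDer χ y) (leftDer χ y ^ k), ← pow_succ',
      Finset.sum_range_succ _ (k + 1), add_smul, smul_add, smul_smul, ← pow_succ]
    abel

/-- Moving the derivation past `e_s` changes its index from `s ◃ r` to `r`. So the induction runs
over all indices at once, with a common value `q` on the diagonal. -/
theorem leftDer_pow_eq_zero {q : K} (hχ : ∀ y, (χ.val y y : K) = q) {m : ℕ} (hm : 0 < m)
    (hq : ∑ i ∈ Finset.range m, q ^ i = 0) (y : X) : leftDer χ y ^ m = 0 := by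
  classical
  obtain ⟨k, rfl⟩ := Nat.exists_eq_succ_of_ne_zero hm.ne'
  ext1 v
  induction v using TV_induction generalizing y with
  | one => simp [pow_succ, leftDer_one]
  | add v w hv hw => rw [map_add, hv, hw]; simp
  | smul a v hv => rw [map_smul, hv]; simp
  | gen_mul s v hv =>
    by_cases h : s = y
    · subst h
      rw [Nat.succ_eq_add_one, leftDer_pow_self_e_mul, hχ, hq, zero_smul, add_zero]
      rw [hv]; simp
    · obtain ⟨r, rfl⟩ : ∃ r, s ◃ r = y := ⟨s ◃⁻¹ y, Rack.right_inv s y⟩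
      have : ∀ j, (leftDer χ (s ◃ r) ^ j) (e K s * v) =
          (χ.val s r : K) ^ j • (e K s * (leftDer χ r ^ j) v) := by
        intro j
        induction j with
        | zero => simp
        | succ j ih => simp [pow_succ', ih, leftDer_e_mul, h, smul_smul, mul_comm]
      rw [this, hv]; simp

/-- The cocycle identity at `(t,s,s)` makes the diagonal invariant under each `g_t`, hence constant
on `Inn X`-orbits. -/
theorem TwoCocycle.val_self_eq (hX : IsIndecomposable X) (x y : X) :
    χ.val x x = χ.val y y := by
  obtain ⟨g, hg, rfl⟩ := hX x y
  have hstep : ∀ t s : X, χ.val (t ◃ s) (t ◃ s) = χ.val s s := fun t s => by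
    have := χ.cocycle t s s
    rw [Quandle.fix, mul_comm] at this
    exact (mul_right_cancel this).symm
  have key : ∀ s, χ.val (g s) (g s) = χ.val s s := by
    induction hg using Subgroup.closure_induction with
    | mem g hg => obtain ⟨t, rfl⟩ := hg; exact hstep t
    | one => simp
    | mul a b _ _ ha hb => intro s; rw [Equiv.Perm.mul_apply, ha, hb]
    | inv a _ ha =>
      intro s
      rw [← ha (a⁻¹ s), ← Equiv.Perm.mul_apply, mul_inv_cancel, Equiv.Perm.one_apply]
  exact (key x).symm

end Quandle

/-! ### Descent to the Nichols algebra and its grading -/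

section Descent

variable {X K : Type*} [Rack X] [Field K] {χ : TwoCocycle X K}

theorem IsAdmissible.coeffGen_eq_zero {J : Ideal (TV X K)} (hJ : IsAdmissible χ J) (x : X)
    {v : TV X K} (hv : v ∈ J) : coeffGen x v = 0 := by
  classical
  rw [← DirectSum.sum_support_decompose (grade X K) v, map_sum]
  refine Finset.sum_eq_zero fun n _ => ?_
  by_cases hn : n = 1
  · subst hn
    rw [hJ.two_le _ (hJ.isHomogeneous 1 hv) 1 (by norm_num) (SetLike.coe_mem _), map_zero]
  · exact coeffGen_eq_zero_of_mem_grade x hn (SetLike.coe_mem _)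

/-- `id ⊗ e_x^*` maps `J ⊗ TV` into `J` and kills `TV ⊗ J`, because `J` has no degree-one part. -/
theorem IsAdmissible.rightDer_mem {J : Ideal (TV X K)} (hJ : IsAdmissible χ J) (x : X)
    {v : TV X K} (hv : v ∈ J) : rightDer χ x v ∈ J := by
  have : coidealSubmodule J ≤ (J.restrictScalars K).comap
      ((TensorProduct.rid K (TV X K)).toLinearMap ∘ₗ LinearMap.lTensor _ (coeffGen x)) := by
    refine sup_le ?_ ?_ <;> rintro _ ⟨z, rfl⟩ <;> induction z using TensorProduct.induction_on with
    | zero => simp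
    | add a b ha hb => rw [map_add]; exact add_mem ha hb
    | tmul a b => ?_
    · simpa using Submodule.smul_mem (J.restrictScalars K) _ a.2
    · simp [hJ.coeffGen_eq_zero x b.2]
  exact this (hJ.coideal v hv)

theorem IsAdmissible.leftDer_mem {J : Ideal (TV X K)} (hJ : IsAdmissible χ J) (y : X)
    {v : TV X K} (hv : v ∈ J) : leftDer χ y v ∈ J := by
  have : coidealSubmodule J ≤ (J.restrictScalars K).comap
      ((TensorProduct.lid K (TV X K)).toLinearMap ∘ₗ LinearMap.rTensor _ (coeffGen y)) := by
    refine sup_le ?_ ?_ <;> rintro _ ⟨z, rfl⟩ <;> induction z using TensorProduct.induction_on with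
    | zero => simp
    | add a b ha hb => rw [map_add]; exact add_mem ha hb
    | tmul a b => ?_
    · simp [hJ.coeffGen_eq_zero y a.2]
    · simpa using Submodule.smul_mem (J.restrictScalars K) _ b.2
  exact this (hJ.coideal v hv)

variable (χ)

/-- The projection of `TV` onto the Nichols algebra, as a linear map. -/
def toNichols : TV X K →ₗ[K] NicholsAlgebra χ :=
  (Ideal.Quotient.mkₐ K (nicholsIdeal χ)).toLinearMap

theorem toNichols_surjective : Function.Surjective (toNichols χ) :=
  Ideal.Quotient.mkₐ_surjective K _

theorem toNichols_eq_zero {v : TV X K} : toNichols χ v = 0 ↔ v ∈ nicholsIdeal χ :=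
  Ideal.Quotient.eq_zero_iff_mem

theorem toNichols_mul (v w : TV X K) :
    toNichols χ (v * w) = toNichols χ v * toNichols χ w :=
  map_mul (Ideal.Quotient.mkₐ K (nicholsIdeal χ)) v w

theorem exists_end_of_mem_nicholsIdeal (f : Module.End K (TV X K))
    (hf : ∀ v ∈ nicholsIdeal χ, f v ∈ nicholsIdeal χ) :
    ∃ g : Module.End K (NicholsAlgebra χ), ∀ v, g (toNichols χ v) = toNichols χ (f v) := by
  have hle : LinearMap.ker (toNichols χ) ≤ LinearMap.ker (toNichols χ ∘ₗ f) := fun v hv =>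
    (toNichols_eq_zero χ).2 (hf v ((toNichols_eq_zero χ).1 hv))
  refine ⟨(LinearMap.ker (toNichols χ)).liftQ (toNichols χ ∘ₗ f) hle ∘ₗ
    ((toNichols χ).quotKerEquivOfSurjective (toNichols_surjective χ)).symm.toLinearMap,
    fun v => ?_⟩
  have : ((toNichols χ).quotKerEquivOfSurjective (toNichols_surjective χ)).symm
      (toNichols χ v) = Submodule.Quotient.mk v := by
    rw [LinearEquiv.symm_apply_eq]; rfl
  rw [LinearMap.comp_apply, LinearEquiv.coe_coe, this]
  rfl

theorem exists_rightDer_nichols (x : X) :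
    ∃ g : Module.End K (NicholsAlgebra χ),
      ∀ v, g (toNichols χ v) = toNichols χ (rightDer χ x v) :=
  exists_end_of_mem_nicholsIdeal χ _ fun _ => (isGreatest_nicholsIdeal χ).1.rightDer_mem x

theorem exists_leftDer_nichols (y : X) :
    ∃ g : Module.End K (NicholsAlgebra χ),
      ∀ v, g (toNichols χ v) = toNichols χ (leftDer χ y v) :=
  exists_end_of_mem_nicholsIdeal χ _ fun _ => (isGreatest_nicholsIdeal χ).1.leftDer_mem y

theorem toNichols_intertwine_pow {f : Module.End K (TV X K)}
    {g : Module.End K (NicholsAlgebra χ)} (h : ∀ v, g (toNichols χ v) = toNichols χ (f v))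
    (n : ℕ) (v : TV X K) : (g ^ n) (toNichols χ v) = toNichols χ ((f ^ n) v) := by
  induction n generalizing v with
  | zero => rfl
  | succ n ih => rw [pow_succ, pow_succ, Module.End.mul_apply, h, ih, Module.End.mul_apply]

theorem toNichols_one_ne_zero : toNichols χ 1 ≠ 0 := fun h =>
  one_ne_zero ((isGreatest_nicholsIdeal χ).1.two_le 1 ((toNichols_eq_zero χ).1 h) 0 (by norm_num)
    (by rw [grade, pow_zero]; exact Submodule.one_le.1 le_rfl))

theorem toNichols_mem_nicholsGrade {n : ℕ} {v : TV X K} (hv : v ∈ grade X K n) :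
    toNichols χ v ∈ nicholsGrade χ n := ⟨v, hv, rfl⟩

theorem exists_of_mem_nicholsGrade {n : ℕ} {b : NicholsAlgebra χ} (hb : b ∈ nicholsGrade χ n) :
    ∃ v ∈ grade X K n, toNichols χ v = b := hb

/-- The ideal is homogeneous, so the degree projections of `TV` descend and separate the components.
-/
theorem iSupIndep_nicholsGrade : iSupIndep (nicholsGrade χ) := by
  classical
  have hproj : ∀ n, ∃ g : Module.End K (NicholsAlgebra χ), ∀ v : TV X K,
      g (toNichols χ v) = toNichols χ (GradedRing.proj (grade X K) n v) := fun n => by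
    refine exists_end_of_mem_nicholsIdeal χ
      ((grade X K n).subtype ∘ₗ DirectSum.component K ℕ (fun i => grade X K i) n ∘ₗ
        (DirectSum.decomposeLinearEquiv (grade X K)).toLinearMap) fun v hv => ?_
    exact (isGreatest_nicholsIdeal χ).1.isHomogeneous n hv
  choose g hg using hproj
  rw [iSupIndep_def]
  intro n
  rw [Submodule.disjoint_def]
  intro b hb hb'
  obtain ⟨v, hv, rfl⟩ := exists_of_mem_nicholsGrade χ hb
  have h1 : g n (toNichols χ v) = toNichols χ v := by
    rw [hg, GradedRing.proj_apply, DirectSum.decompose_of_mem_same _ hv]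
  have h2 : (⨆ j, ⨆ (_ : j ≠ n), nicholsGrade χ j) ≤ LinearMap.ker (g n) := by
    refine iSup₂_le fun j hj b hb => ?_
    obtain ⟨w, hw, rfl⟩ := exists_of_mem_nicholsGrade χ hb
    rw [LinearMap.mem_ker, hg, GradedRing.proj_apply, DirectSum.decompose_of_mem_ne _ hw hj,
      map_zero]
  rw [← h1]
  exact h2 hb'

theorem exists_nicholsGrade_eq_bot [Module.Finite K (NicholsAlgebra χ)] :
    ∃ N, ∀ n, N ≤ n → nicholsGrade χ n = ⊥ := by
  have hfin := WellFoundedGT.finite_ne_bot_of_iSupIndep (iSupIndep_nicholsGrade χ)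
  obtain ⟨N, hN⟩ := hfin.bddAbove
  exact ⟨N + 1, fun n hn => by_contra fun h => absurd (hN h) (by omega)⟩

end Descent

theorem exists_polynomial_eq_mk_finrank {K M : Type*} [Field K] [AddCommGroup M] [Module K M]
    {A : ℕ → Submodule K M} (h : ∃ N, ∀ n, N ≤ n → A n = ⊥) :
    ∃ P : Polynomial ℤ,
      PowerSeries.mk (fun n => (Module.finrank K (A n) : ℤ)) = (P : PowerSeries ℤ) := by
  obtain ⟨N, hN⟩ := h
  refine ⟨PowerSeries.trunc N (PowerSeries.mk fun n => (Module.finrank K (A n) : ℤ)), ?_⟩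
  ext n
  rw [Polynomial.coeff_coe, PowerSeries.coeff_trunc]
  split_ifs with hn
  · rfl
  · rw [PowerSeries.coeff_mk, hN n (not_lt.1 hn), finrank_bot, Nat.cast_zero]

/-- For `q = 1` the sum is the image of `n` in `K`, which detects the characteristic instead; hence
the separate case in the main theorem. -/
theorem sum_pow_eq_zero_iff {K : Type*} [Field K] {q : K} (hq : q ≠ 1) (n : ℕ) :
    ∑ i ∈ Finset.range n, q ^ i = 0 ↔ q ^ n = 1 := by
  rw [geom_sum_eq hq, div_eq_zero_iff, sub_eq_zero, or_iff_left (sub_ne_zero.2 hq)]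

/-! ### Roots of unity and the double splitting -/

section Quandle

variable {X K : Type*} [Quandle X] [Field K] {χ : TwoCocycle X K}

theorem exists_rightMul_nichols (x : X) :
    ∃ R : Module.End K (NicholsAlgebra χ),
      ∀ v, R (toNichols χ v) = toNichols χ (v * e K x) :=
  ⟨LinearMap.mulRight K (toNichols χ (e K x)), fun v => by
    rw [LinearMap.mulRight_apply, toNichols_mul]⟩

/-- A finite-dimensional Nichols algebra forces `χ(x,x)` to be a root of unity. -/
theorem exists_val_self_pow_eq_one [Module.Finite K (NicholsAlgebra χ)] (x : X) :
    ∃ m, 0 < m ∧ (χ.val x x : K) ^ m = 1 := by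
  by_contra! hq
  have hq1 : (χ.val x x : K) ≠ 1 := by simpa using hq 1 one_pos
  obtain ⟨E, hE⟩ := exists_rightDer_nichols χ x
  obtain ⟨R, hR⟩ := exists_rightMul_nichols (χ := χ) x
  have hER : ∀ b, E (R b) = b + (χ.val x x : K) • R (E b) := fun b => by
    obtain ⟨v, rfl⟩ := toNichols_surjective χ b
    rw [hR, hE, hE, hR, rightDer_mul_e, map_add, map_smul]
  obtain ⟨N, hN⟩ := exists_nicholsGrade_eq_bot χ
  have h1 : E (toNichols χ 1) = 0 := by rw [hE, rightDer_one, map_zero]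
  have hmem : (R ^ N) (toNichols χ 1) ∈ nicholsGrade χ N := by
    have := raise_pow_mem (A := nicholsGrade χ) (R := R) (fun n b hb => by
      obtain ⟨v, hv, rfl⟩ := exists_of_mem_nicholsGrade χ hb
      rw [hR]
      exact toNichols_mem_nicholsGrade χ (mul_e_mem_grade x hv)) N 0
      (toNichols_mem_nicholsGrade χ (v := 1)
        (by rw [grade, pow_zero]; exact Submodule.one_le.1 le_rfl))
    rwa [zero_add] at this
  -- `R^N(1)` vanishes for degree reasons, yet `E^N` sends it to a nonzero multiple of `1`.
  rw [hN N le_rfl, Submodule.mem_bot] at hmem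
  have key := qWeyl_pow_pow hER N h1
  rw [hmem, map_zero] at key
  refine smul_ne_zero (Finset.prod_ne_zero_iff.2 fun k _ => ?_) (toNichols_one_ne_zero χ) key.symm
  rw [Ne, sum_pow_eq_zero_iff hq1]
  exact hq _ k.succ_pos

/-- The diagonal is constant, so one entry decides the order; `h` excludes the default value `0` of
`sInf ∅`. -/
theorem TwoCocycle.order_eq_orderOf (hX : IsIndecomposable X) (x : X)
    (h : ∃ m, 0 < m ∧ (χ.val x x : K) ^ m = 1) :
    0 < χ.order ∧ χ.order = orderOf (χ.val x x : K) := by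
  have hset : {m : ℕ | 0 < m ∧ ∀ t : X, χ.val t t ^ m = 1} =
      {m : ℕ | 0 < m ∧ (χ.val x x : K) ^ m = 1} := by
    ext m
    simp only [Set.mem_ofPred_eq, ← Units.val_pow_eq_pow_val, Units.val_eq_one]
    exact and_congr_right fun _ =>
      ⟨fun h => h x, fun h t => by rw [χ.val_self_eq hX t x, h]⟩
  have hmem : χ.order ∈ {m : ℕ | 0 < m ∧ (χ.val x x : K) ^ m = 1} := by
    rw [TwoCocycle.order, hset]
    exact Nat.sInf_mem h
  refine ⟨hmem.1, le_antisymm ?_ (orderOf_le_of_pow_eq_one hmem.1 hmem.2)⟩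
  rw [TwoCocycle.order, hset]
  exact Nat.sInf_le ⟨orderOf_pos_iff.2 (isOfFinOrder_iff_pow_eq_one.2 h), pow_orderOf_eq_one _⟩

/-- If all `χ(t,t)` equal a primitive `m`-th root of unity `q ≠ 1`, then two distinct elements
`x`, `y` of `X` split two factors `(m)_t` off the Hilbert series. -/
theorem hilbertSeries_eq_qNumber_sq_mul [Module.Finite K (NicholsAlgebra χ)] {q : K} (hq1 : q ≠ 1)
    (hχ : ∀ t, (χ.val t t : K) = q) (hm : 0 < orderOf q) {x y : X} (hxy : y ≠ x) :
    ∃ P : Polynomial ℤ,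
      hilbertSeries χ = ((qNumber (orderOf q) ^ 2 * P : Polynomial ℤ) : PowerSeries ℤ) := by
  obtain ⟨E, hE⟩ := exists_rightDer_nichols χ x
  obtain ⟨R, hR⟩ := exists_rightMul_nichols (χ := χ) x
  obtain ⟨D, hD⟩ := exists_leftDer_nichols χ y
  let L : Module.End K (NicholsAlgebra χ) := LinearMap.mulLeft K (toNichols χ (e K y))
  have hL : ∀ v, L (toNichols χ v) = toNichols χ (e K y * v) := fun v =>
    (toNichols_mul χ _ v).symm
  have hsurj := toNichols_surjective χ
  have hzero : ∀ b ∈ nicholsGrade χ 0, ∃ a : K, b = a • toNichols χ 1 := fun b hb => by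
    obtain ⟨v, hv, rfl⟩ := exists_of_mem_nicholsGrade χ hb
    obtain ⟨a, rfl⟩ := exists_of_mem_grade_zero hv
    exact ⟨a, map_smul _ _ _⟩
  have hsum0 : ∑ i ∈ Finset.range (orderOf q), q ^ i = 0 :=
    (sum_pow_eq_zero_iff hq1 _).2 (pow_orderOf_eq_one q)
  have hsum : ∀ k, k + 1 < orderOf q → ∑ i ∈ Finset.range (k + 1), q ^ i ≠ 0 := fun k hk h =>
    pow_ne_one_of_lt_orderOf k.succ_ne_zero hk ((sum_pow_eq_zero_iff hq1 _).1 h)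
  have hEgr : ∀ n, ∀ b ∈ nicholsGrade χ (n + 1), E b ∈ nicholsGrade χ n := fun n b hb => by
    obtain ⟨v, hv, rfl⟩ := exists_of_mem_nicholsGrade χ hb
    rw [hE]
    exact toNichols_mem_nicholsGrade χ (rightDer_mem_grade χ x hv)
  have hDgr : ∀ n, ∀ b ∈ nicholsGrade χ (n + 1), D b ∈ nicholsGrade χ n := fun n b hb => by
    obtain ⟨v, hv, rfl⟩ := exists_of_mem_nicholsGrade χ hb
    rw [hD]
    exact toNichols_mem_nicholsGrade χ (leftDer_mem_grade χ y hv)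
  have hRgr : ∀ n, ∀ b ∈ nicholsGrade χ n, R b ∈ nicholsGrade χ (n + 1) := fun n b hb => by
    obtain ⟨v, hv, rfl⟩ := exists_of_mem_nicholsGrade χ hb
    rw [hR]
    exact toNichols_mem_nicholsGrade χ (mul_e_mem_grade x hv)
  have hLgr : ∀ n, ∀ b ∈ nicholsGrade χ n, L b ∈ nicholsGrade χ (n + 1) := fun n b hb => by
    obtain ⟨v, hv, rfl⟩ := exists_of_mem_nicholsGrade χ hb
    rw [hL]
    exact toNichols_mem_nicholsGrade χ (e_mul_mem_grade y hv)
  have hE0 : ∀ b ∈ nicholsGrade χ 0, E b = 0 := fun b hb => by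
    obtain ⟨a, rfl⟩ := hzero b hb
    rw [map_smul, hE, rightDer_one, map_zero, smul_zero]
  have hD0 : ∀ b ∈ nicholsGrade χ 0, D b = 0 := fun b hb => by
    obtain ⟨a, rfl⟩ := hzero b hb
    rw [map_smul, hD, leftDer_one, map_zero, smul_zero]
  have hER : ∀ b, E (R b) = b + q • R (E b) := fun b => by
    obtain ⟨v, rfl⟩ := hsurj b
    rw [hR, hE, hE, hR, rightDer_mul_e, map_add, map_smul, hχ]
  have hDL : ∀ b, D (L b) = b + q • L (D b) := fun b => by
    obtain ⟨v, rfl⟩ := hsurj b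
    rw [hL, hD, hD, hL, leftDer_self_e_mul, map_add, map_smul, hχ]
  have hED : ∀ b, E b = 0 → E (D b) = 0 := fun b hb => by
    rw [← map_zero D, ← hb]
    obtain ⟨v, rfl⟩ := hsurj b
    rw [hE, hD, hE, hD, leftDer_rightDer]
  -- Here `y ≠ x` is essential: it removes the `g_y` term from `E(e_y v)`.
  have hEL : ∀ b, E b = 0 → E (L b) = 0 := fun b hb => by
    rw [← map_zero L, ← hb]
    obtain ⟨v, rfl⟩ := hsurj b
    rw [hE, hL, hE, hL, rightDer_e_mul, if_neg hxy, add_zero]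
  have hEm : E ^ orderOf q = 0 := LinearMap.ext fun b => by
    obtain ⟨v, rfl⟩ := hsurj b
    rw [toNichols_intertwine_pow χ hE, rightDer_pow_eq_zero χ x hm (by rw [hχ, hsum0])]
    simp
  have hDm : D ^ orderOf q = 0 := LinearMap.ext fun b => by
    obtain ⟨v, rfl⟩ := hsurj b
    rw [toNichols_intertwine_pow χ hD, leftDer_pow_eq_zero χ hχ hm hsum0]
    simp
  have h1 := mk_finrank_eq_qNumber_mul hER hEgr hE0 hRgr hEm hsum
  -- The second splitting takes place inside the graded subspace `ker E`.
  have h2 := mk_finrank_eq_qNumber_mul (A := fun n => nicholsGrade χ n ⊓ LinearMap.ker E) hDL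
    (fun n b hb => ⟨hDgr n b hb.1, hED b hb.2⟩) (fun b hb => hD0 b hb.1)
    (fun n b hb => ⟨hLgr n b hb.1, hEL b hb.2⟩) hDm hsum
  obtain ⟨P, hP⟩ := exists_polynomial_eq_mk_finrank
    (A := fun n => nicholsGrade χ n ⊓ LinearMap.ker E ⊓ LinearMap.ker D) (by
      obtain ⟨N, hN⟩ := exists_nicholsGrade_eq_bot χ
      exact ⟨N, fun n hn => by rw [hN n hn, bot_inf_eq, bot_inf_eq]⟩)
  refine ⟨P, ?_⟩
  rw [hilbertSeries, h1, h2, hP, ← Polynomial.coe_mul, ← Polynomial.coe_mul, ← mul_assoc, sq]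

end Quandle

end Nichols
end

theorem mainTheorem4 {X K : Type*} [Quandle X] [Finite X] [Field K]
    (hX : Nichols.IsIndecomposable X) (hcard : 3 ≤ Nat.card X)
    (χ : Nichols.TwoCocycle X K) (hfin : Module.Finite K (Nichols.NicholsAlgebra χ)) :
    0 < χ.order ∧
      ∃ P : Polynomial ℤ,
        Nichols.hilbertSeries χ = ((Nichols.qNumber χ.order ^ 2 * P : Polynomial ℤ) : PowerSeries ℤ) := by
  have : Nontrivial X := Finite.one_lt_card_iff_nontrivial.1 (by omega)
  obtain ⟨y, x, hyx⟩ := exists_pair_ne X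
  have hroot := Nichols.exists_val_self_pow_eq_one (χ := χ) x
  obtain ⟨hpos, hord⟩ := χ.order_eq_orderOf hX x hroot
  refine ⟨hpos, ?_⟩
  rw [hord] at hpos ⊢
  -- For `q = 1` the order is `1` and `(1)_t = 1`, so only polynomiality of the Hilbert series is
  -- left.
  by_cases hq1 : (χ.val x x : K) = 1
  · obtain ⟨P, hP⟩ :=
      Nichols.exists_polynomial_eq_mk_finrank (Nichols.exists_nicholsGrade_eq_bot χ)
    refine ⟨P, ?_⟩
    rw [hq1, orderOf_one, Nichols.qNumber, Finset.sum_range_one, pow_zero, one_pow, one_mul]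
    exact hP
  · exact Nichols.hilbertSeries_eq_qNumber_sq_mul hq1
      (fun t => by rw [χ.val_self_eq hX t x]) hpos hyx
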